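/- Let $A$ be an ordered set (the alphabet) equipped with an order-preserving involution $a\mapsto\bar a$. Extend the involution to words by $\overline{a_0\cdots a_{n-1}}=\overline{a_{n-1}}\cdots\overline{a_0}$, and order the set $A^*$ of words by the Higman ordering: $\alpha\le\beta$ if $\alpha$ is dominated letter by letter by a subsequence of $\beta$. A final segment of $A^*$ is a subset that is closed upwards for this ordering. A transition system $M=(Q,T)$, $T\subseteq Q\times A\times Q$, is called reflexive and involutive if for all states $x,y$ and all letters $a\le b$: $(x,a,x)\in T$; $(x,a,y)\in T$ implies $(y,\bar a,x)\in T$; and $(x,a,y)\in T$ implies $(x,b,y)\in T$. An automaton $(M,\{x\},\{y\})$ is reflexive and involutive if $M$ is. Let $d_M(x,y)$ be the language accepted by the automaton $(M,\{x\},\{y\})$. A morphism of automata is a map of states that preserves transitions, initial states and final states, and it is an isometric embedding if it preserves the distances $d_M$. For a final segment $F$ of $A^*$ let $S_F$ be the set of all residuals $FY^{-1}=\{\alpha\in A^*:\alpha Y\subseteq F\}$, $Y$ a final segment. For $p,q\in S_F$ let $d(p,q)$ be the largest final segment $r$ with $pr\subseteq q$ and $q\bar r\subseteq p$. Let $M_F$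 be the transition system on $S_F$ with transitions $(p,a,q)$ for the letters $a\in d(p,q)$, and let $\mathcal A_F:=(M_F,\{A^*\},\{F\})$. Then $\mathcal A_F$ is a reflexive and involutive automaton accepting $F$, and $(S_F,d_{M_F})$ is the injective envelope of its subspace $\{A^*,F\}$ among the metric spaces over the final segments of $A^*$ (values being ordered by reverse inclusion, with concatenation as addition and $A^*$ as zero). Moreover, let $\mathcal A=(M,\{x\},\{y\})$ be a reflexive and involutive automaton accepting a final segment $F$ of $A^*$. Then $\mathcal A$ is isomorphic to $\mathcal A_F$ if and only if for every reflexive and involutive automaton $\mathcal A'=(M',\{x'\},\{y'\})$ accepting $F$ the following two properties hold: (i) every morphism of automata $f:\mathcal A\to\mathcal A'$, if any, is an isometric embedding; (ii) the map sending $x'$ to $x$ and $y'$ to $y$ extends to a morphism of automata from $\mathcal A'$ to $\mathcal A$. -/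

import Mathlib

universe u v w z

namespace MetricAutomata

section Words

variable {A : Type u}

/-- The involution extended to words: the bar of `a₀ ⋯ aₙ₋₁` is `star aₙ₋₁ ⋯ star a₀`. -/
def wordBar [Star A] (α : List A) : List A := (α.map star).reverse

/-- The involution extended to languages: the set of all `wordBar α` with `α ∈ X`. -/
def langBar [Star A] (X : Language A) : Language A := wordBar '' X

/-- The Higman (subword) ordering on words over an ordered alphabet: `α ≤ β` if `α` is dominated,
letter by letter, by a subsequence of `β`. -/
def HigmanLE [PartialOrder A] (α β : List A) : Prop := List.SublistForall₂ (· ≤ ·) α β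

/-- Final segments of the set of words, for the Higman ordering. They are the values of the
distances below. As values, they are ordered by *reverse* inclusion, the monoid operation is the
concatenation `X * Y` of languages, and the neutral (and least) element is the set `⊤` of all
words. -/
def IsFinalSegment [PartialOrder A] (X : Language A) : Prop :=
  ∀ ⦃α β : List A⦄, HigmanLE α β → α ∈ X → β ∈ X

/-- The residual `X⁻¹ F`. -/
def leftResidual (X F : Language A) : Language A := {β | ∀ α ∈ X, α ++ β ∈ F}

/-- The residual `F Y⁻¹`. -/
def rightResidual (F Y : Language A) : Language A := {α | ∀ β ∈ Y, α ++ β ∈ F}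

/-- The distance `d_H` on the algebra of final segments: `valueDist p q` is, for reverse inclusion,
the least final segment `r` with `p ≤ q * langBar r` and `q ≤ p * r`; this is the join (for reverse
inclusion, i.e. the intersection) of two residuals. -/
def valueDist [Star A] (p q : Language A) : Language A :=
  rightResidual (langBar p) (langBar q) ⊓ leftResidual p q

end Words

section Metric

variable {A : Type u}

/-- `d` is a distance on `E` with values in the final segments of the set of words (so the
inequalities between values are reverse inclusions). -/
structure IsDistance [PartialOrder A] [Star A] {E : Type v} (d : E → E → Language A) : Prop where
  isFinalSegment : ∀ p q, IsFinalSegment (d p q)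
  eq_top_iff : ∀ p q, d p q = ⊤ ↔ p = q
  triangle : ∀ p q r, d p r * d r q ≤ d p q
  symm : ∀ p q, d p q = langBar (d q p)

/-- Contractions (non-expansive maps). For reverse inclusion this is `d' (f p) (f q) ≤ d p q`. -/
def IsContraction {E : Type v} {E' : Type w} (d : E → E → Language A)
    (d' : E' → E' → Language A) (f : E → E') : Prop :=
  ∀ p q, d p q ≤ d' (f p) (f q)

/-- Isometric embeddings. -/
def IsIsometric {E : Type v} {E' : Type w} (d : E → E → Language A)
    (d' : E' → E' → Language A) (f : E → E') : Prop :=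
  ∀ p q, d' (f p) (f q) = d p q

/-- Injective metric spaces: contractions into the space extend along isometric embeddings. -/
def IsInjectiveSpace [PartialOrder A] [Star A] {E : Type v} (d : E → E → Language A) : Prop :=
  ∀ (E₁ E₂ : Type w) (d₁ : E₁ → E₁ → Language A) (d₂ : E₂ → E₂ → Language A),
    IsDistance d₁ → IsDistance d₂ →
    ∀ (f : E₁ → E) (g : E₁ → E₂), IsContraction d₁ d f → IsIsometric d₁ d₂ g →
      ∃ h : E₂ → E, IsContraction d₂ d h ∧ h ∘ g = f

/-- Essential contractions. -/
def IsEssential [PartialOrder A] [Star A] {E : Type v} {E' : Type z} (d : E → E → Language A)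
    (d' : E' → E' → Language A) (f : E → E') : Prop :=
  IsContraction d d' f ∧
    ∀ (E₂ : Type w) (d₂ : E₂ → E₂ → Language A), IsDistance d₂ →
      ∀ g : E' → E₂, IsContraction d' d₂ g → (IsIsometric d d₂ (g ∘ f) ↔ IsIsometric d' d₂ g)

/-- The metric space `(E, d)` is an injective envelope of its subspace `X`: it is injective and the
inclusion of `X` is essential. The universe `w` is the one of the test spaces. -/
structure IsInjectiveEnvelope [PartialOrder A] [Star A] {E : Type v} (X : Set E)
    (d : E → E → Language A) : Prop where
  isDistance : IsDistance d
  isInjectiveSpace : IsInjectiveSpace.{u, v, w} d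
  isEssential : IsEssential.{u, v, w, v} (fun p q : X => d p q) d (Subtype.val : X → E)

end Metric

section Automata

variable {A : Type u}

/-- A transition system on the alphabet `A` with set of states `Q`: a set of transitions. -/
structure TransitionSystem (A : Type u) (Q : Type v) where
  /-- The set of transitions. -/
  T : Set (Q × A × Q)

/-- The automaton `(M, I, F)`, as a nondeterministic automaton in the sense of Mathlib; the language
that it accepts is `(M.automaton I F).accepts`. -/
def TransitionSystem.automaton {Q : Type v} (M : TransitionSystem A Q) (I F : Set Q) : NFA A Q where
  step p a := {q | (p, a, q) ∈ M.T}
  start := I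
  accept := F

/-- `d_M(x, y)`: the language accepted by the automaton `(M, {x}, {y})`. -/
def TransitionSystem.dist {Q : Type v} (M : TransitionSystem A Q) (x y : Q) : Language A :=
  (M.automaton {x} {y}).accepts

/-- Reflexive and involutive transition systems over an ordered alphabet with involution. -/
structure TransitionSystem.IsReflexiveInvolutive [PartialOrder A] [Star A] {Q : Type v}
    (M : TransitionSystem A Q) : Prop where
  refl : ∀ x a, (x, a, x) ∈ M.T
  inv : ∀ x a y, (x, a, y) ∈ M.T → (y, star a, x) ∈ M.T
  up : ∀ x a b y, a ≤ b → (x, a, y) ∈ M.T → (x, b, y) ∈ M.T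

/-- Morphisms of automata. -/
structure IsMorphism {Q : Type v} {Q' : Type w} (𝒜 : NFA A Q) (𝒜' : NFA A Q') (f : Q → Q') :
    Prop where
  step : ∀ p a q, q ∈ 𝒜.step p a → f q ∈ 𝒜'.step (f p) a
  start : f '' 𝒜.start ⊆ 𝒜'.start
  accept : f '' 𝒜.accept ⊆ 𝒜'.accept

/-- Isomorphic automata. -/
def IsIsomorphic {Q : Type v} {Q' : Type w} (𝒜 : NFA A Q) (𝒜' : NFA A Q') : Prop :=
  ∃ f : Q ≃ Q', IsMorphism 𝒜 𝒜' f ∧ IsMorphism 𝒜' 𝒜 f.symm ∧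
    f '' 𝒜.start = 𝒜'.start ∧ f '' 𝒜.accept = 𝒜'.accept

end Automata

section Envelope

variable {A : Type u}

/-- The set `S_F` of all residuals `F Y⁻¹`, where `Y` is a final segment. -/
def EnvelopeState [PartialOrder A] (F : Language A) : Type u :=
  {p : Language A // ∃ Y : Language A, IsFinalSegment Y ∧ p = rightResidual F Y}

/-- The transition system `M_F` on `S_F`: `(p, a, q)` is a transition if the letter `a`, as a word
of length one, belongs to the distance of `p` and `q`. -/
def envelopeSystem [PartialOrder A] [Star A] (F : Language A) :
    TransitionSystem A (EnvelopeState F) where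
  T := {t | [t.2.1] ∈ valueDist t.1.1 t.2.2.1}

/-- The initial state of `A_F`: the set of all words, which is the residual of `F` by `∅`. -/
def envelopeInitial [PartialOrder A] (F : Language A) : EnvelopeState F :=
  ⟨⊤, ⊥, fun _ _ _ h => h.elim, (Set.eq_univ_of_forall fun _ _ h => h.elim).symm⟩

theorem rightResidual_top_of_isFinalSegment [PartialOrder A] {F : Language A}
    (hF : IsFinalSegment F) : F = rightResidual F ⊤ := by
  ext α
  constructor
  · intro hα β _
    exact hF (List.sublistForall₂_iff.2
      ⟨α, List.forall₂_same.2 fun _ _ => le_rfl, List.sublist_append_left α β⟩) hα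
  · intro h
    have h' := h [] trivial
    rwa [List.append_nil] at h'

/-- The final state of `A_F`: the final segment `F`, which is its own residual by the set of all
words. -/
def envelopeFinal [PartialOrder A] {F : Language A} (hF : IsFinalSegment F) : EnvelopeState F :=
  ⟨F, ⊤, fun _ _ _ _ => trivial, rightResidual_top_of_isFinalSegment hF⟩

/-- The envelope automaton `A_F`. -/
def envelopeAutomaton [PartialOrder A] [Star A] {F : Language A} (hF : IsFinalSegment F) :
    NFA A (EnvelopeState F) :=
  (envelopeSystem F).automaton {envelopeInitial F} {envelopeFinal hF}

end Envelope

end MetricAutomata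

open MetricAutomata

/-!
The metric `d_M` of a reflexive involutive transition system `M` takes values in the final segments
of `A^*`, separates states because the empty word is accepted only between equal states, and turns
transitions into distances: `(p, a, q)` is a transition iff the one-letter word `a` lies in
`d_M(p, q)`. Hence the morphisms of transition systems are exactly the contractions.

A state `p` of the envelope is a residual of `F`, so it is recovered from `p⁻¹ F` as `F (p⁻¹ F)⁻¹`
(`EnvelopeState.mem_iff`): a word lies in `p` as soon as all its products with `p⁻¹ F` lie in `F`.
This Galois connection carries the whole argument.

* A word `a w` in `valueDist p q` factors through the state `F R⁻¹`, where `R` consists of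
  the words that any intermediate state is forced to have in its left residual
  (`exists_intermediate`). So `d_{M_F}` is `valueDist` (`dist_envelopeSystem`).
* A contraction `f` given on a part of a space extends to a point `z` as the residual of `F` by
  `⋃ᵢ d(z, gᵢ) (fᵢ⁻¹ F)` (`extension`): the envelope is injective.
* The distances of `p` to the two end points are `p` and `p⁻¹ F`. As `valueDist p q` is determined
  by `p` and `q⁻¹ F`, any contraction on the envelope that preserves the distance of the end points
  is an isometry (`isometric_of_endpoints`), and a self-contraction fixing them is the identity
  (`eq_self_of_fixes_endpoints`).

For the characterization, a morphism from `M` to the envelope exists by injectivity, is isometric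
by (i), hence injective, and it is surjective because composing it with the morphism given by (ii)
yields a self-contraction of the envelope that fixes the end points.
-/

namespace MetricAutomata

/-! ### Words and final segments -/

section Words

variable {A : Type u}

@[simp]
theorem wordBar_nil [Star A] : wordBar ([] : List A) = [] := rfl

theorem wordBar_cons [Star A] (a : A) (α : List A) :
    wordBar (a :: α) = wordBar α ++ [star a] := by
  simp [wordBar]

theorem wordBar_append [Star A] (α β : List A) :
    wordBar (α ++ β) = wordBar β ++ wordBar α := by
  simp [wordBar]

@[simp]
theorem wordBar_wordBar [InvolutiveStar A] (α : List A) : wordBar (wordBar α) = α := by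
  simp [wordBar, Function.comp_def]

theorem mem_langBar [InvolutiveStar A] {X : Language A} {α : List A} :
    α ∈ langBar X ↔ wordBar α ∈ X := by
  constructor
  · rintro ⟨β, hβ, rfl⟩
    rwa [wordBar_wordBar]
  · exact fun h => ⟨wordBar α, h, wordBar_wordBar α⟩

theorem mem_valueDist [InvolutiveStar A] {p q : Language A} {α : List A} :
    α ∈ valueDist p q ↔
      (∀ β ∈ p, β ++ α ∈ q) ∧ ∀ β ∈ q, β ++ wordBar α ∈ p := by
  constructor
  · rintro ⟨h₁, h₂⟩
    refine ⟨h₂, fun β hβ => ?_⟩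
    have h := mem_langBar.1 (h₁ (wordBar β) ⟨β, hβ, rfl⟩)
    rwa [wordBar_append, wordBar_wordBar] at h
  · rintro ⟨h₁, h₂⟩
    refine ⟨fun β hβ => mem_langBar.2 ?_, h₁⟩
    rw [wordBar_append]
    exact h₂ _ (mem_langBar.1 hβ)

variable [PartialOrder A]

theorem IsFinalSegment.mem_of_sublist {X : Language A} (hX : IsFinalSegment X) {α β : List A}
    (h : α.Sublist β) (hα : α ∈ X) : β ∈ X :=
  hX h.sublistForall₂ hα

theorem HigmanLE.append_left {α β : List A} (h : HigmanLE α β) (γ : List A) :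
    HigmanLE (γ ++ α) (γ ++ β) := by
  induction γ with
  | nil => exact h
  | cons c γ ih => exact .cons le_rfl ih

theorem isFinalSegment_leftResidual {F : Language A} (hF : IsFinalSegment F) (X : Language A) :
    IsFinalSegment (leftResidual X F) :=
  fun _ _ h hα γ hγ => hF (h.append_left γ) (hα γ hγ)

end Words

/-! ### The distance of a transition system -/

section Systems

variable {A : Type u} {Q : Type v} {Q' : Type w}

namespace TransitionSystem

@[simp]
theorem nil_mem_dist (M : TransitionSystem A Q) {p q : Q} : [] ∈ M.dist p q ↔ p = q := by
  simp [dist, NFA.accepts_eq_acceptsFrom_start, automaton, eq_comm]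

theorem cons_mem_dist (M : TransitionSystem A Q) {p q : Q} {a : A} {α : List A} :
    a :: α ∈ M.dist p q ↔ ∃ r, (p, a, r) ∈ M.T ∧ α ∈ M.dist r q := by
  simp only [dist, NFA.mem_accepts, automaton, NFA.evalFrom_cons, NFA.stepSet_singleton,
    Set.mem_singleton_iff, exists_eq_left]
  rw [NFA.mem_evalFrom_iff_exists]
  rfl

theorem singleton_mem_dist (M : TransitionSystem A Q) {p q : Q} {a : A} :
    [a] ∈ M.dist p q ↔ (p, a, q) ∈ M.T := by
  simp [cons_mem_dist]

theorem append_mem_dist (M : TransitionSystem A Q) {p q r : Q} {α β : List A}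
    (hα : α ∈ M.dist p r) (hβ : β ∈ M.dist r q) : α ++ β ∈ M.dist p q := by
  induction α generalizing p with
  | nil => rwa [M.nil_mem_dist.1 hα]
  | cons a α ih =>
    obtain ⟨s, hs, hα⟩ := M.cons_mem_dist.1 hα
    exact M.cons_mem_dist.2 ⟨s, hs, ih hα⟩

/-- The distance is the least relation containing the transitions and closed under composition. -/
theorem isContraction_of_transition {M : TransitionSystem A Q} {M' : TransitionSystem A Q'}
    {f : Q → Q'} (h : ∀ p a q, (p, a, q) ∈ M.T → (f p, a, f q) ∈ M'.T) :
    IsContraction M.dist M'.dist f := by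
  intro p q α hα
  induction α generalizing p with
  | nil => rw [M.nil_mem_dist.1 hα]; exact M'.nil_mem_dist.2 rfl
  | cons a α ih =>
    obtain ⟨s, hs, hα⟩ := M.cons_mem_dist.1 hα
    exact M'.cons_mem_dist.2 ⟨f s, h _ _ _ hs, ih s hα⟩

theorem isMorphism_iff {M : TransitionSystem A Q} {M' : TransitionSystem A Q'} {f : Q → Q'}
    {x y : Q} {x' y' : Q'} :
    IsMorphism (M.automaton {x} {y}) (M'.automaton {x'} {y'}) f ↔
      IsContraction M.dist M'.dist f ∧ f x = x' ∧ f y = y' := by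
  constructor
  · intro h
    exact ⟨isContraction_of_transition fun p a q hpq => h.step p a q hpq,
      h.start ⟨x, rfl, rfl⟩, h.accept ⟨y, rfl, rfl⟩⟩
  · rintro ⟨h, rfl, rfl⟩
    refine ⟨fun p a q hpq => ?_, ?_, ?_⟩
    · exact M'.singleton_mem_dist.1 (h p q (M.singleton_mem_dist.2 hpq))
    · rintro _ ⟨z, rfl, rfl⟩; rfl
    · rintro _ ⟨z, rfl, rfl⟩; rfl

theorem isIsomorphic_iff {M : TransitionSystem A Q}
    {M' : TransitionSystem A Q'} {x y : Q} {x' y' : Q'} :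
    IsIsomorphic (M.automaton {x} {y}) (M'.automaton {x'} {y'}) ↔
      ∃ f : Q ≃ Q', IsIsometric M.dist M'.dist f ∧ f x = x' ∧ f y = y' := by
  constructor
  · rintro ⟨f, hf, hf', -⟩
    obtain ⟨h, hx, hy⟩ := isMorphism_iff.1 hf
    refine ⟨f, fun p q => le_antisymm ?_ (h p q), hx, hy⟩
    simpa using (isMorphism_iff.1 hf').1 (f p) (f q)
  · rintro ⟨f, h, rfl, rfl⟩
    refine ⟨f, isMorphism_iff.2 ⟨fun p q => (h p q).ge, rfl, rfl⟩,
      isMorphism_iff.2 ⟨fun p q => ?_, by simp, by simp⟩,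
      Set.image_singleton, Set.image_singleton⟩
    simpa using (h (f.symm p) (f.symm q)).le

variable [PartialOrder A] [InvolutiveStar A]

namespace IsReflexiveInvolutive

variable {M : TransitionSystem A Q}

theorem mem_dist_self (hM : M.IsReflexiveInvolutive) (p : Q) (α : List A) : α ∈ M.dist p p := by
  induction α with
  | nil => exact M.nil_mem_dist.2 rfl
  | cons a α ih => exact M.cons_mem_dist.2 ⟨p, hM.refl p a, ih⟩

theorem isFinalSegment_dist (hM : M.IsReflexiveInvolutive) (p q : Q) :
    IsFinalSegment (M.dist p q) := by
  intro α β h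
  induction h generalizing p with
  | nil =>
    intro hα
    rw [M.nil_mem_dist.1 hα]
    exact hM.mem_dist_self _ _
  | cons hab _ ih =>
    intro hα
    obtain ⟨s, hs, hα⟩ := M.cons_mem_dist.1 hα
    exact M.cons_mem_dist.2 ⟨s, hM.up _ _ _ _ hab hs, ih s hα⟩
  | cons_right _ ih =>
    intro hα
    exact M.cons_mem_dist.2 ⟨p, hM.refl _ _, ih p hα⟩

theorem wordBar_mem_dist (hM : M.IsReflexiveInvolutive) {p q : Q} {α : List A}
    (h : α ∈ M.dist p q) : wordBar α ∈ M.dist q p := by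
  induction α generalizing p with
  | nil => rw [M.nil_mem_dist.1 h]; exact M.nil_mem_dist.2 rfl
  | cons a α ih =>
    obtain ⟨s, hs, hα⟩ := M.cons_mem_dist.1 h
    rw [wordBar_cons]
    exact M.append_mem_dist (ih hα) (M.singleton_mem_dist.2 (hM.inv _ _ _ hs))

theorem isDistance_dist (hM : M.IsReflexiveInvolutive) : IsDistance M.dist where
  isFinalSegment := hM.isFinalSegment_dist
  eq_top_iff p q := by
    constructor
    · intro h
      exact M.nil_mem_dist.1 (h ▸ trivial)
    · rintro rfl
      exact top_le_iff.1 fun α _ => hM.mem_dist_self p α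
  triangle p q r := by
    intro γ hγ
    obtain ⟨α, hα, β, hβ, rfl⟩ := Language.mem_mul.1 hγ
    exact M.append_mem_dist hα hβ
  symm p q := by
    ext α
    rw [mem_langBar]
    exact ⟨hM.wordBar_mem_dist, fun h => wordBar_wordBar α ▸ hM.wordBar_mem_dist h⟩

end IsReflexiveInvolutive

end TransitionSystem

end Systems

section Distance

variable {A : Type u} [PartialOrder A] [InvolutiveStar A] {E : Type v} {d : E → E → Language A}

theorem IsDistance.append_mem (hd : IsDistance d) {p q r : E} {α β : List A}
    (hα : α ∈ d p r) (hβ : β ∈ d r q) : α ++ β ∈ d p q :=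
  hd.triangle p q r (Language.append_mem_mul hα hβ)

theorem IsDistance.wordBar_mem (hd : IsDistance d) {p q : E} {α : List A} (h : α ∈ d p q) :
    wordBar α ∈ d q p := by
  rw [hd.symm, mem_langBar] at h
  exact h

theorem IsDistance.mem_self (hd : IsDistance d) (p : E) (α : List A) : α ∈ d p p := by
  rw [(hd.eq_top_iff p p).2 rfl]
  trivial

end Distance

/-! ### States of the envelope as closed sets of a Galois connection -/

section Envelope

variable {A : Type u} [PartialOrder A] {F : Language A}

theorem EnvelopeState.mem_iff (p : EnvelopeState F) {α : List A} :
    α ∈ p.1 ↔ ∀ β ∈ leftResidual p.1 F, α ++ β ∈ F := by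
  obtain ⟨_, Y, _, rfl⟩ := p
  exact ⟨fun hα β hβ => hβ α hα, fun h β hβ => h β fun γ hγ => hγ β hβ⟩

theorem EnvelopeState.isFinalSegment (hF : IsFinalSegment F) (p : EnvelopeState F) :
    IsFinalSegment p.1 := by
  intro α β h hα
  rw [p.mem_iff] at hα ⊢
  intro γ hγ
  obtain ⟨l, hl, hs⟩ := List.sublistForall₂_iff.1 h
  exact hF (List.sublistForall₂_iff.2 ⟨l ++ γ,
    List.rel_append hl (List.forall₂_same.2 fun _ _ => le_rfl), hs.append_right γ⟩) (hα γ hγ)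

/-- The residual of `F` by an arbitrary language `Y`, as a state: it is also the residual of `F` by
the final segment `(F Y⁻¹)⁻¹ F`. -/
def EnvelopeState.ofResidual (hF : IsFinalSegment F) (Y : Language A) : EnvelopeState F :=
  ⟨rightResidual F Y, leftResidual (rightResidual F Y) F, isFinalSegment_leftResidual hF _, by
    ext α
    exact ⟨fun hα β hβ => hβ α hα, fun h β hβ => h β fun γ hγ => hγ β hβ⟩⟩

/-- Every state contains `F`, the state which is the residual by all words. -/
theorem EnvelopeState.mem_of_mem (hF : IsFinalSegment F) (p : EnvelopeState F) {α : List A}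
    (hα : α ∈ F) : α ∈ p.1 :=
  p.mem_iff.2 fun β _ => hF.mem_of_sublist (List.sublist_append_left α β) hα

/-! ### The distance on the envelope -/

variable [InvolutiveStar A]

/-- Convexity of the envelope: a distance `a α` is realized by an intermediate state. -/
theorem exists_intermediate (hF : IsFinalSegment F) {p q : EnvelopeState F} {a : A} {α : List A}
    (h : a :: α ∈ valueDist p.1 q.1) :
    ∃ r : EnvelopeState F, [a] ∈ valueDist p.1 r.1 ∧ α ∈ valueDist r.1 q.1 := by
  obtain ⟨h₁, h₂⟩ := mem_valueDist.1 h
  refine ⟨.ofResidual hF ({γ | ∃ β ∈ leftResidual p.1 F, γ = star a :: β} ⊔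
    {γ | ∃ β ∈ leftResidual q.1 F, γ = α ++ β}), mem_valueDist.2 ⟨?_, ?_⟩,
    mem_valueDist.2 ⟨?_, ?_⟩⟩
  · rintro γ hγ _ (⟨β, hβ, rfl⟩ | ⟨β, hβ, rfl⟩)
    · refine hF.mem_of_sublist ?_ (hβ γ hγ)
      rw [List.append_assoc]
      exact (List.Sublist.refl γ).append ((List.sublist_cons_self _ β).trans
        (List.sublist_append_right [a] _))
    · simpa using hβ _ (h₁ γ hγ)
  · intro γ hγ
    refine p.mem_iff.2 fun β hβ => ?_
    simpa [wordBar] using hγ (star a :: β) (Or.inl ⟨β, hβ, rfl⟩)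
  · intro γ hγ
    refine q.mem_iff.2 fun β hβ => ?_
    simpa using hγ (α ++ β) (Or.inr ⟨β, hβ, rfl⟩)
  · rintro γ hγ _ (⟨β, hβ, rfl⟩ | ⟨β, hβ, rfl⟩)
    · simpa [wordBar_cons] using hβ _ (h₂ γ hγ)
    · refine hF.mem_of_sublist ?_ (hβ γ hγ)
      rw [List.append_assoc]
      exact (List.Sublist.refl γ).append
        ((List.sublist_append_right α β).trans (List.sublist_append_right _ _))

theorem isReflexiveInvolutive_envelopeSystem (hstar : Monotone (star : A → A))
    (hF : IsFinalSegment F) : (envelopeSystem F).IsReflexiveInvolutive where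
  refl p a := by
    have hp := p.isFinalSegment hF
    exact mem_valueDist.2 ⟨fun β hβ => hp.mem_of_sublist (List.sublist_append_left β _) hβ,
      fun β hβ => hp.mem_of_sublist (List.sublist_append_left β _) hβ⟩
  inv p a q h := by
    obtain ⟨h₁, h₂⟩ := mem_valueDist.1 h
    exact mem_valueDist.2 ⟨h₂, by simpa [wordBar] using h₁⟩
  up p a b q hab h := by
    obtain ⟨h₁, h₂⟩ := mem_valueDist.1 h
    refine mem_valueDist.2 ⟨fun β hβ => ?_, fun β hβ => ?_⟩
    · exact q.isFinalSegment hF (HigmanLE.append_left (.cons hab .nil) β) (h₁ β hβ)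
    · exact p.isFinalSegment hF (HigmanLE.append_left (.cons (hstar hab) .nil) β) (h₂ β hβ)

theorem dist_envelopeSystem (hF : IsFinalSegment F) (p q : EnvelopeState F) :
    (envelopeSystem F).dist p q = valueDist p.1 q.1 := by
  ext α
  induction α generalizing p with
  | nil =>
    rw [TransitionSystem.nil_mem_dist, mem_valueDist]
    simp only [wordBar_nil, List.append_nil]
    exact ⟨fun h => by simp [h], fun h => Subtype.ext (Set.Subset.antisymm h.1 h.2)⟩
  | cons a α ih =>
    rw [TransitionSystem.cons_mem_dist]
    constructor
    · rintro ⟨r, hr, hα⟩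
      obtain ⟨h₁, h₂⟩ := mem_valueDist.1 hr
      obtain ⟨h₃, h₄⟩ := mem_valueDist.1 ((ih r).1 hα)
      refine mem_valueDist.2 ⟨fun β hβ => ?_, fun β hβ => ?_⟩
      · simpa using h₃ _ (h₁ β hβ)
      · simpa [wordBar_cons] using h₂ _ (h₄ β hβ)
    · intro h
      obtain ⟨r, hr, hα⟩ := exists_intermediate hF h
      exact ⟨r, hr, (ih r).2 hα⟩

theorem mem_dist_initial (hF : IsFinalSegment F) {p : EnvelopeState F} {α : List A} :
    α ∈ (envelopeSystem F).dist (envelopeInitial F) p ↔ α ∈ p.1 := by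
  rw [dist_envelopeSystem hF, mem_valueDist]
  refine ⟨fun h => h.1 [] trivial, fun h => ⟨fun β _ => ?_, fun _ _ => trivial⟩⟩
  exact (p.isFinalSegment hF).mem_of_sublist (List.sublist_append_right β α) h

theorem mem_dist_final (hF : IsFinalSegment F) {p : EnvelopeState F} {α : List A} :
    α ∈ (envelopeSystem F).dist p (envelopeFinal hF) ↔ α ∈ leftResidual p.1 F := by
  rw [dist_envelopeSystem hF, mem_valueDist]
  refine ⟨fun h => h.1, fun h => ⟨h, fun β hβ => p.mem_of_mem hF ?_⟩⟩
  exact hF.mem_of_sublist (List.sublist_append_left β _) hβ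

theorem accepts_envelopeAutomaton (hF : IsFinalSegment F) :
    (envelopeAutomaton hF).accepts = F := by
  change (envelopeSystem F).dist _ _ = F
  ext α
  exact mem_dist_initial hF

/-! ### Injectivity and rigidity of the envelope -/

/-- Hyperconvexity in functional form: a family of states of the envelope whose mutual distances
are bounded by those of points `g i` of a metric space is the trace on these points of a
contraction. -/
theorem extension (hF : IsFinalSegment F) {ι : Type w} {E : Type z} {d : E → E → Language A}
    (hd : IsDistance d) (f : ι → EnvelopeState F) (g : ι → E)
    (h : ∀ i j, d (g i) (g j) ≤ (envelopeSystem F).dist (f i) (f j)) :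
    ∃ k : E → EnvelopeState F, IsContraction d (envelopeSystem F).dist k ∧ ∀ i, k (g i) = f i := by
  -- `Y z` gathers the words that `k z` must have in its left residual; `k z` is the largest
  -- language allowed by this constraint.
  let Y : E → Language A := fun z =>
    {γ | ∃ i, ∃ α ∈ d z (g i), ∃ β ∈ leftResidual (f i).1 F, γ = α ++ β}
  have key : ∀ z z' : E, ∀ α ∈ d z z', ∀ γ ∈ rightResidual F (Y z),
      γ ++ α ∈ rightResidual F (Y z') := by
    rintro z z' α hα γ hγ _ ⟨i, δ, hδ, β, hβ, rfl⟩
    simpa using hγ _ ⟨i, α ++ δ, hd.append_mem hα hδ, β, hβ, rfl⟩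
  refine ⟨fun z => .ofResidual hF (Y z), fun z z' α hα => ?_, fun i => Subtype.ext ?_⟩
  · rw [dist_envelopeSystem hF]
    exact mem_valueDist.2 ⟨key z z' α hα, key z' z _ (hd.wordBar_mem hα)⟩
  · change rightResidual F (Y (g i)) = (f i).1
    ext γ
    rw [(f i).mem_iff]
    constructor
    · intro hγ β hβ
      exact hγ β ⟨i, [], hd.mem_self _ _, β, hβ, rfl⟩
    · rintro hγ _ ⟨j, α, hα, β, hβ, rfl⟩
      have hij := h i j hα
      rw [dist_envelopeSystem hF] at hij
      have := hβ _ ((mem_valueDist.1 hij).1 γ ((f i).mem_iff.2 hγ))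
      rwa [List.append_assoc] at this

/-- A metric space with two points at distance `F` has a contraction to the envelope that maps them
to the end points. -/
theorem exists_contraction_to_envelope (hF : IsFinalSegment F)
    (hE : IsDistance (envelopeSystem F).dist) {E : Type z} {d : E → E → Language A}
    (hd : IsDistance d) {x y : E} (hxy : d x y = F) :
    ∃ k : E → EnvelopeState F, IsContraction d (envelopeSystem F).dist k ∧
      k x = envelopeInitial F ∧ k y = envelopeFinal hF := by
  have hxy' : d x y = (envelopeSystem F).dist (envelopeInitial F) (envelopeFinal hF) :=
    hxy.trans (accepts_envelopeAutomaton hF).symm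
  obtain ⟨k, hk, hki⟩ := extension hF hd
    (fun b : Bool => cond b (envelopeInitial F) (envelopeFinal hF)) (fun b => cond b x y) (by
      rintro (_ | _) (_ | _)
      · exact fun α _ => hE.mem_self _ α
      · rw [cond_false, cond_true, cond_false, cond_true, hd.symm, hE.symm, hxy']
      · exact hxy'.le
      · exact fun α _ => hE.mem_self _ α)
  exact ⟨k, hk, hki true, hki false⟩

/-- The inclusion of the end points in the envelope is essential. -/
theorem isometric_of_endpoints (hF : IsFinalSegment F) {E : Type z} {d : E → E → Language A}
    (hd : IsDistance d) {g : EnvelopeState F → E} (hg : IsContraction (envelopeSystem F).dist d g)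
    (h : d (g (envelopeInitial F)) (g (envelopeFinal hF)) = F) :
    IsIsometric (envelopeSystem F).dist d g := by
  have key : ∀ p q : EnvelopeState F, ∀ α ∈ d (g p) (g q), ∀ β ∈ p.1, β ++ α ∈ q.1 := by
    intro p q α hα β hβ
    refine q.mem_iff.2 fun γ hγ => ?_
    have hβ' : β ∈ d (g (envelopeInitial F)) (g p) := hg _ _ ((mem_dist_initial hF).2 hβ)
    have hγ' : γ ∈ d (g q) (g (envelopeFinal hF)) := hg _ _ ((mem_dist_final hF).2 hγ)
    exact h ▸ hd.append_mem (hd.append_mem hβ' hα) hγ'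
  refine fun p q => le_antisymm (fun α hα => ?_) (hg p q)
  rw [dist_envelopeSystem hF]
  exact mem_valueDist.2 ⟨key p q α hα, key q p _ (hd.wordBar_mem hα)⟩

/-- The envelope is rigid over its end points. -/
theorem eq_self_of_fixes_endpoints (hF : IsFinalSegment F) {φ : EnvelopeState F → EnvelopeState F}
    (hφ : IsContraction (envelopeSystem F).dist (envelopeSystem F).dist φ)
    (h₀ : φ (envelopeInitial F) = envelopeInitial F)
    (h₁ : φ (envelopeFinal hF) = envelopeFinal hF) (p : EnvelopeState F) : φ p = p := by
  refine Subtype.ext (Set.Subset.antisymm (fun α hα => p.mem_iff.2 fun β hβ => ?_) fun α hα => ?_)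
  · have h := hφ _ _ ((mem_dist_final hF).2 hβ)
    rw [h₁] at h
    exact (mem_dist_final hF).1 h α hα
  · have h := hφ _ _ ((mem_dist_initial hF).2 hα)
    rw [h₀] at h
    exact (mem_dist_initial hF).1 h

theorem isInjectiveEnvelope_envelopeSystem (hstar : Monotone (star : A → A))
    (hF : IsFinalSegment F) :
    IsInjectiveEnvelope.{u, u, w} {envelopeInitial F, envelopeFinal hF}
      (envelopeSystem F).dist where
  isDistance := (isReflexiveInvolutive_envelopeSystem hstar hF).isDistance_dist
  isInjectiveSpace := by
    intro E₁ E₂ d₁ d₂ _ hd₂ f g hf hg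
    obtain ⟨k, hk, hki⟩ := extension hF hd₂ f g fun i j => (hg i j).le.trans (hf i j)
    exact ⟨k, hk, funext hki⟩
  isEssential := by
    refine ⟨fun p q => le_rfl, fun E₂ d₂ hd₂ g hg => ⟨fun h => ?_, fun h p q => h p q⟩⟩
    refine isometric_of_endpoints hF hd₂ hg ?_
    exact (h ⟨_, Or.inl rfl⟩ ⟨_, Or.inr rfl⟩).trans (accepts_envelopeAutomaton hF)

/-! ### The characterization of the envelope automaton -/

/-- The envelope system with its states lifted to another universe. -/
def liftedEnvelope (F : Language A) : TransitionSystem A (ULift.{w} (EnvelopeState F)) where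
  T := {t | (t.1.down, t.2.1, t.2.2.down) ∈ (envelopeSystem F).T}

theorem dist_liftedEnvelope (p q : ULift.{w} (EnvelopeState F)) :
    (liftedEnvelope F).dist p q = (envelopeSystem F).dist p.down q.down :=
  le_antisymm
    (TransitionSystem.isContraction_of_transition (M := liftedEnvelope F)
      (M' := envelopeSystem F) (f := ULift.down) (fun _ _ _ h => h) p q)
    (TransitionSystem.isContraction_of_transition (M := envelopeSystem F)
      (M' := liftedEnvelope F) (f := ULift.up) (fun _ _ _ h => h) p.down q.down)

end Envelope

end MetricAutomata

/-- The first conjunct says that `A_F` is a reflexive and involutive automaton accepting `F` whose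
metric space of states is the injective envelope of the set formed by its initial and its final
state. The second one is the characterization of `A_F`. -/
theorem theorem1 {A : Type u} [PartialOrder A] [InvolutiveStar A]
    (hstar : Monotone (star : A → A)) {F : Language A} (hF : IsFinalSegment F)
    {Q : Type v} (M : TransitionSystem A Q) (x y : Q) (hM : M.IsReflexiveInvolutive)
    (hacc : (M.automaton {x} {y}).accepts = F) :
    ((envelopeSystem F).IsReflexiveInvolutive ∧
      (envelopeAutomaton hF).accepts = F ∧
      IsInjectiveEnvelope.{u, u, w} {envelopeInitial F, envelopeFinal hF}
        (envelopeSystem F).dist) ∧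
    (IsIsomorphic (M.automaton {x} {y}) (envelopeAutomaton hF) ↔
      ∀ (Q' : Type (max u w)) (M' : TransitionSystem A Q') (x' y' : Q'),
        M'.IsReflexiveInvolutive → (M'.automaton {x'} {y'}).accepts = F →
        (∀ f : Q → Q', IsMorphism (M.automaton {x} {y}) (M'.automaton {x'} {y'}) f →
          IsIsometric M.dist M'.dist f) ∧
        (∃ g : Q' → Q, g x' = x ∧ g y' = y ∧
          IsMorphism (M'.automaton {x'} {y'}) (M.automaton {x} {y}) g)) := by
  have hR := isReflexiveInvolutive_envelopeSystem hstar hF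
  have hE := hR.isDistance_dist
  refine ⟨⟨hR, accepts_envelopeAutomaton hF, isInjectiveEnvelope_envelopeSystem hstar hF⟩, ?_⟩
  constructor
  · intro hiso
    obtain ⟨e, he, hex, hey⟩ := TransitionSystem.isIsomorphic_iff.1 hiso
    have hesymm : ∀ p q, M.dist (e.symm p) (e.symm q) = (envelopeSystem F).dist p q :=
      fun p q => by simpa using (he (e.symm p) (e.symm q)).symm
    intro Q' M' x' y' hM' hacc'
    refine ⟨fun f hf => ?_, ?_⟩
    · obtain ⟨hf, hfx, hfy⟩ := TransitionSystem.isMorphism_iff.1 hf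
      have h := isometric_of_endpoints hF hM'.isDistance_dist (g := f ∘ e.symm)
        (fun p q => (hesymm p q).ge.trans (hf _ _))
        (by rw [← hex, ← hey]; simpa [hfx, hfy, TransitionSystem.dist] using hacc')
      intro p q
      simpa [he p q] using h (e p) (e q)
    · obtain ⟨k, hk, hkx, hky⟩ := exists_contraction_to_envelope hF hE hM'.isDistance_dist hacc'
      have hx : e.symm (k x') = x := by rw [hkx, ← hex, e.symm_apply_apply]
      have hy : e.symm (k y') = y := by rw [hky, ← hey, e.symm_apply_apply]
      exact ⟨e.symm ∘ k, hx, hy, TransitionSystem.isMorphism_iff.2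
        ⟨fun p q => (hk p q).trans (hesymm _ _).ge, hx, hy⟩⟩
  · intro H
    obtain ⟨k, hk, hkx, hky⟩ := exists_contraction_to_envelope hF hE hM.isDistance_dist hacc
    obtain ⟨hiso, g, hgx, hgy, hg⟩ := H (ULift.{max u w} (EnvelopeState F)) (liftedEnvelope F)
      ⟨envelopeInitial F⟩ ⟨envelopeFinal hF⟩
      ⟨fun p => hR.refl p.down, fun p a q => hR.inv p.down a q.down,
        fun p a b q => hR.up p.down a b q.down⟩
      ((dist_liftedEnvelope _ _).trans (accepts_envelopeAutomaton hF))
    have hkiso : IsIsometric M.dist (envelopeSystem F).dist k := fun p q =>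
      (dist_liftedEnvelope _ _).symm.trans
        (hiso (fun p => ⟨k p⟩) (TransitionSystem.isMorphism_iff.2
          ⟨fun p q => (hk p q).trans (dist_liftedEnvelope _ _).ge,
            congrArg ULift.up hkx, congrArg ULift.up hky⟩) p q)
    have hgc := (TransitionSystem.isMorphism_iff.1 hg).1
    have hkg : ∀ p, k (g ⟨p⟩) = p := eq_self_of_fixes_endpoints hF (φ := fun p => k (g ⟨p⟩))
      (fun p q => (dist_liftedEnvelope ⟨p⟩ ⟨q⟩).ge.trans ((hgc _ _).trans (hk _ _)))
      (by simp [hgx, hkx]) (by simp [hgy, hky])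
    -- An isometry of metric spaces is injective: equal points are those at distance `⊤`.
    have hinj : Function.Injective k := fun p q hpq =>
      (hM.isDistance_dist.eq_top_iff p q).1
        ((hkiso p q).symm.trans ((hE.eq_top_iff _ _).2 hpq))
    exact TransitionSystem.isIsomorphic_iff.2
      ⟨Equiv.ofBijective k ⟨hinj, fun p => ⟨_, hkg p⟩⟩, hkiso, hkx, hky⟩
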